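/- All graphs are undirected, without loops or multiple edges. A graph embeds in another if it is isomorphic to an induced subgraph of it; two graphs are equimorphic if each embeds in the other. The age of a graph $G$ is the set of finite graphs that embed in $G$, considered up to isomorphism; it is wqo if it is well-quasi-ordered by embeddability (equivalently, it has no infinite antichain). A graph $G$ is path-minimal if it contains finite induced paths of unbounded length and embeds in each of its induced subgraphs that contain finite induced paths of unbounded length. A module of $G=(V,E)$ is a set $A\subseteq V$ such that every $v\in V\setminus A$ is adjacent either to all or to none of the vertices of $A$; $G$ is prime if it has more than three vertices and its only modules are $\emptyset$, the singletons and $V$. Theorem. There are $2^{\aleph_0}$ path-minimal graphs that are not prime, whose ages are wqo and pairwise incomparable with respect to inclusion, and such that every graph equimorphic to one of them is also not prime. Moreover, these graphs can be chosen, up to isomorphism, of the following form: for a uniformly recurrent word $x:\mathbb N\to\{0,1\}$ (for every $n$ there is $m$ such that each factor of $x$ of length $n$ occurs in every factor of $x$ of length $m$) and finite intervals $J_0,J_1,\dots$ of $\mathbb N$ of unbounded length, the vertex set is $\{(n,k): n\in\mathbb N,\ k\in J_n\}$; the vertices $(n,k)$ and $(n,k')$ are adjacent if and only if $|k-k'|=1$;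 and for $n<n'$ the vertices $(n,k)$ and $(n',k')$ are adjacent if and only if $x(k')=1$. -/

import Mathlib

universe u v w

namespace PathMinimal

/-- `G` and `H` are equimorphic: each is isomorphic to an induced subgraph of the other. -/
def Equimorphic {V : Type u} {W : Type v} (G : SimpleGraph V) (H : SimpleGraph W) : Prop :=
  Nonempty (G ↪g H) ∧ Nonempty (H ↪g G)

/-- Finite graphs, represented up to isomorphism on the vertex sets `Fin n`. -/
abbrev FinGraph : Type := Σ n : ℕ, SimpleGraph (Fin n)

/-- The embeddability quasi-order on finite graphs. -/
def FinGraph.Embeds (A B : FinGraph) : Prop := Nonempty (A.2 ↪g B.2)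

/-- The age of `G`: the finite graphs (up to isomorphism) that embed in `G`. -/
def age {V : Type u} (G : SimpleGraph V) : Set FinGraph :=
  {A | Nonempty (A.2 ↪g G)}

/-- The age of `G` is well-quasi-ordered by embeddability. -/
def HasWqoAge {V : Type u} (G : SimpleGraph V) : Prop :=
  (age G).PartiallyWellOrderedOn FinGraph.Embeds

/-- `G` contains finite induced paths of unbounded length (an induced path on `n` vertices
contains induced paths on `m` vertices for all `m ≤ n`). -/
def HasUnboundedPaths {V : Type u} (G : SimpleGraph V) : Prop :=
  ∀ n : ℕ, Nonempty (SimpleGraph.pathGraph n ↪g G)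

/-- `G` is path-minimal. -/
def IsPathMinimal {V : Type u} (G : SimpleGraph V) : Prop :=
  HasUnboundedPaths G ∧
    ∀ A : Set V, HasUnboundedPaths (G.induce A) → Nonempty (G ↪g G.induce A)

/-- `A` is a module (autonomous set) of `G`. -/
def IsModuleSet {V : Type u} (G : SimpleGraph V) (A : Set V) : Prop :=
  ∀ v, v ∉ A → (∀ a ∈ A, G.Adj v a) ∨ (∀ a ∈ A, ¬ G.Adj v a)

/-- `G` is prime: it has more than three vertices, and its only modules are the empty set,
the singletons and the whole vertex set. -/
def IsPrimeGraph {V : Type u} (G : SimpleGraph V) : Prop :=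
  3 < ENat.card V ∧
    ∀ A : Set V, IsModuleSet G A → A = ∅ ∨ (∃ a, A = {a}) ∨ A = Set.univ

/-- The word `x` on `ℕ` is uniformly recurrent: for every `n` there is `m` such that every factor
of length `n` (starting at `p`) occurs inside every factor of length `m` (starting at `q`). -/
def UniformlyRecurrent {L : Type u} (x : ℕ → L) : Prop :=
  ∀ n : ℕ, ∃ m : ℕ, ∀ p q : ℕ, ∃ r : ℕ, q ≤ r ∧ r + n ≤ q + m ∧
    ∀ i < n, x (r + i) = x (p + i)

/-- The lexicographical sum, over the chain `I` and with respect to `star : L → L → {0, 1}`, of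
copies of the graph `G` labelled by `l`, with the labels removed afterwards. -/
def lexSum (I : Type u) [LinearOrder I] {V : Type v} {L : Type w} (star : L → L → Fin 2)
    (G : SimpleGraph V) (l : V → L) : SimpleGraph (I × V) where
  Adj p q :=
    (p.1 = q.1 ∧ G.Adj p.2 q.2) ∨ (p.1 < q.1 ∧ star (l p.2) (l q.2) = 1) ∨
      (q.1 < p.1 ∧ star (l q.2) (l p.2) = 1)
  symm := ⟨by
    rintro p q (⟨h, h'⟩ | h | h)
    · exact Or.inl ⟨h.symm, h'.symm⟩
    · exact Or.inr (Or.inr h)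
    · exact Or.inr (Or.inl h)⟩
  loopless := ⟨by
    rintro p (⟨_, h⟩ | ⟨h, _⟩ | ⟨h, _⟩)
    · exact G.loopless.irrefl _ h
    · exact lt_irrefl _ h
    · exact lt_irrefl _ h⟩

/-- The second projection `i ⋆ j = j` on `{0, 1}`. -/
def sndProj : Fin 2 → Fin 2 → Fin 2 := fun _ j => j

/-- The lexicographical sum over `ω` of copies of the infinite path on `ℕ` in which the vertex `n`
is labelled `x n`, with the labels removed. -/
def wordSum {L : Type w} (star : L → L → Fin 2) (x : ℕ → L) : SimpleGraph (ℕ × ℕ) :=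
  lexSum ℕ star (SimpleGraph.hasse ℕ) x

/-- A sequence of finite intervals of `ℕ` of unbounded length. -/
def IsUnboundedIntervalFamily (J : ℕ → Set ℕ) : Prop :=
  (∀ n, (J n).OrdConnected) ∧ (∀ n, (J n).Finite) ∧ ∀ k : ℕ, ∃ n, k ≤ (J n).ncard

/-- The induced subgraph of `wordSum star x` on the union of the sets `{n} × J n`. -/
def wordSumOn {L : Type w} (star : L → L → Fin 2) (x : ℕ → L) (J : ℕ → Set ℕ) :
    SimpleGraph {p : ℕ × ℕ | p.2 ∈ J p.1} :=
  (wordSum star x).induce {p : ℕ × ℕ | p.2 ∈ J p.1}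

end PathMinimal

namespace PathMinimal

/-! ### Toeplitz words -/

/-- The word whose `n`-th letter is the letter of `c` indexed by the `3`-adic valuation of
`n + 1`. -/
def toeplitzWord {L : Type u} (c : ℕ → L) (n : ℕ) : L := c (padicValNat 3 (n + 1))

theorem padicValNat_three_add_mul {m k : ℕ} (h : ¬ 3 ^ k ∣ m) (t : ℕ) :
    padicValNat 3 (m + t * 3 ^ k) = padicValNat 3 m := by
  have hm : m ≠ 0 := by rintro rfl; exact h (dvd_zero _)
  have key : ∀ i, i ≤ padicValNat 3 (m + t * 3 ^ k) ↔ i ≤ padicValNat 3 m := by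
    intro i
    rw [← padicValNat_dvd_iff_le (by omega), ← padicValNat_dvd_iff_le hm]
    rcases le_total i k with hi | hi
    · exact (Nat.dvd_add_iff_left (Dvd.dvd.mul_left (pow_dvd_pow 3 hi) t)).symm
    · refine iff_of_false (fun hd => h ?_) (fun hd => h ((pow_dvd_pow 3 hi).trans hd))
      exact (Nat.dvd_add_iff_left (Dvd.intro_left t rfl)).2 ((pow_dvd_pow 3 hi).trans hd)
  exact le_antisymm ((key _).1 le_rfl) ((key _).2 le_rfl)

theorem toeplitzWord_add_mul {L : Type u} (c : ℕ → L) {n k : ℕ} (h : ¬ 3 ^ k ∣ n + 1) (t : ℕ) :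
    toeplitzWord c (n + t * 3 ^ k) = toeplitzWord c n := by
  unfold toeplitzWord
  rw [add_right_comm, padicValNat_three_add_mul h]

/-- A word over a finite alphabet in which every letter recurs periodically is uniformly
recurrent. -/
theorem UniformlyRecurrent.of_periodic {L : Type u} [Finite L] {x : ℕ → L}
    (h : ∀ n, ∃ M, 0 < M ∧ ∀ t, x (n + t * M) = x n) : UniformlyRecurrent x := by
  choose M hM0 hM using h
  intro n
  let F : ℕ → Fin n → L := fun p i => x (p + i)
  choose s hs using fun w : Set.range F => w.2
  have := Fintype.ofFinite (Set.range F)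
  let T : ℕ → ℕ := fun p => ∏ i ∈ Finset.range n, M (p + i)
  have hT : ∀ p t i, i < n → x (p + i + t * T p) = x (p + i) := by
    intro p t i hi
    obtain ⟨e, he⟩ := Finset.dvd_prod_of_mem (fun i => M (p + i)) (Finset.mem_range.2 hi)
    have : t * T p = (t * e) * M (p + i) := by
      simp only [T, he]; ring
    rw [this, hM]
  have hT0 : ∀ p, 0 < T p := fun p => Finset.prod_pos fun i _ => hM0 _
  refine ⟨(∑ w, (s w + T (s w))) + n, fun p q => ?_⟩
  let w : Set.range F := ⟨F p, p, rfl⟩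
  have hw : s w + T (s w) ≤ ∑ w, (s w + T (s w)) :=
    Finset.single_le_sum (f := fun w => s w + T (s w)) (fun _ _ => Nat.zero_le _)
      (Finset.mem_univ w)
  have h1 := Nat.div_add_mod q (T (s w))
  have h2 := Nat.mod_lt q (hT0 (s w))
  refine ⟨s w + (q / T (s w) + 1) * T (s w), ?_, ?_, fun i hi => ?_⟩
  · rw [add_mul, mul_comm (q / _)]; omega
  · rw [add_mul, mul_comm (q / _)]; omega
  · rw [add_right_comm, hT _ _ _ hi]
    exact congrFun (hs w) ⟨i, hi⟩

theorem uniformlyRecurrent_toeplitzWord {L : Type u} [Finite L] (c : ℕ → L) :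
    UniformlyRecurrent (toeplitzWord c) :=
  .of_periodic fun n => ⟨3 ^ (padicValNat 3 (n + 1) + 1), by positivity, fun t =>
    toeplitzWord_add_mul c (pow_succ_padicValNat_not_dvd (by omega)) t⟩

/-- If `c` and `c'` first differ at `j`, then the windows of length `3 ^ (j + 1)` of the two
Toeplitz words never contain the same number of ones. -/
theorem card_ones_toeplitzWord_lt {c c' : ℕ → Fin 2} {j : ℕ} (hlt : ∀ i < j, c i = c' i)
    (hj : c j = 1) (hj' : c' j = 0) (p q : ℕ) :
    ((Finset.Ico q (q + 3 ^ (j + 1))).filter fun n => toeplitzWord c' n = 1).card <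
      ((Finset.Ico p (p + 3 ^ (j + 1))).filter fun n => toeplitzWord c n = 1).card := by
  set N := 3 ^ (j + 1) with hN
  have hNpos : 0 < N := by positivity
  let P : (ℕ → Fin 2) → ℕ → Prop := fun c n => ¬ N ∣ n + 1 ∧ toeplitzWord c n = 1
  have hdvd : Function.Periodic (fun n => N ∣ n + 1) N := fun n => by
    simp only [eq_iff_iff]
    rw [add_right_comm]
    exact (Nat.dvd_add_iff_left dvd_rfl).symm
  have hP : ∀ c, Function.Periodic (P c) N := by
    intro c n
    have h1 := hdvd n
    simp only [eq_iff_iff] at h1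
    simp only [P, eq_iff_iff, h1]
    refine and_congr_right fun h => ?_
    have := toeplitzWord_add_mul c h 1
    rw [one_mul] at this
    rw [this]
  classical
  have hcP := fun c n => Nat.filter_Ico_card_eq_of_periodic n N (P c) (hP c)
  have hcD := fun n => Nat.filter_Ico_card_eq_of_periodic n N (fun n => N ∣ n + 1) hdvd
  have hD : N.count (fun n => N ∣ n + 1) ≤ 1 := by
    rw [Nat.count_eq_card_filter_range]
    refine (Finset.card_le_card (t := {N - 1}) fun n hn => ?_).trans_eq (Finset.card_singleton _)
    simp only [Finset.mem_filter, Finset.mem_range, Finset.mem_singleton] at hn ⊢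
    have := Nat.le_of_dvd (by omega) hn.2
    omega
  have hup : ((Finset.Ico q (q + N)).filter fun n => toeplitzWord c' n = 1).card ≤
      N.count (P c') + 1 := by
    refine le_trans ?_ (Nat.add_le_add_left hD _)
    rw [← hcP c' q, ← hcD q]
    refine le_trans (Finset.card_le_card ?_) (Finset.card_union_le _ _)
    intro n hn
    simp only [Finset.mem_filter, Finset.mem_union, P] at hn ⊢
    tauto
  have hlow : N.count (P c) ≤
      ((Finset.Ico p (p + N)).filter fun n => toeplitzWord c n = 1).card := by
    rw [← hcP c p]
    refine Finset.card_le_card fun n hn => ?_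
    simp only [Finset.mem_filter, P] at hn ⊢
    tauto
  have hgap : N.count (P c') + 2 ≤ N.count (P c) := by
    have h3 : 0 < 3 ^ j := by positivity
    have hN3 : N = 3 * 3 ^ j := by rw [hN, pow_succ, mul_comm]
    have hv1 : padicValNat 3 (3 ^ j) = j := padicValNat.prime_pow j
    have hv2 : padicValNat 3 (2 * 3 ^ j) = j := by
      rw [padicValNat.mul (by norm_num) h3.ne', hv1,
        padicValNat.eq_zero_of_not_dvd (by norm_num), zero_add]
    have e1 : 3 ^ j - 1 + 1 = 3 ^ j := by omega
    have e2 : 2 * 3 ^ j - 1 + 1 = 2 * 3 ^ j := by omega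
    have hne : 3 ^ j - 1 ≠ 2 * 3 ^ j - 1 := by omega
    have hdisj : Disjoint ((Finset.range N).filter (P c'))
        {3 ^ j - 1, 2 * 3 ^ j - 1} := by
      rw [Finset.disjoint_left]
      intro n hn hn'
      simp only [Finset.mem_filter, Finset.mem_insert, Finset.mem_singleton] at hn hn'
      simp only [P, toeplitzWord] at hn
      have h1 := hn.2.2
      rcases hn' with rfl | rfl
      · rw [e1, hv1, hj'] at h1; exact zero_ne_one h1
      · rw [e2, hv2, hj'] at h1; exact zero_ne_one h1
    rw [Nat.count_eq_card_filter_range, Nat.count_eq_card_filter_range]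
    refine le_trans ?_ (Finset.card_le_card
      (s := (Finset.range N).filter (P c') ∪ {3 ^ j - 1, 2 * 3 ^ j - 1}) ?_)
    · rw [Finset.card_union_of_disjoint hdisj, Finset.card_pair hne]
    · intro n hn
      simp only [Finset.mem_union, Finset.mem_filter, Finset.mem_range, Finset.mem_insert,
        Finset.mem_singleton] at hn ⊢
      simp only [P, toeplitzWord] at hn ⊢
      rcases hn with ⟨hn, hd, h1⟩ | rfl | rfl
      · refine ⟨hn, hd, ?_⟩
        have hv : padicValNat 3 (n + 1) < j + 1 := by
          by_contra hv
          exact hd ((padicValNat_dvd_iff_le (by omega)).2 (not_lt.1 hv))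
        rcases Nat.lt_succ_iff_lt_or_eq.1 hv with hv | hv
        · rw [hlt _ hv, h1]
        · rw [hv, hj]
      · rw [e1, hv1]
        exact ⟨by omega, fun hd => by have := Nat.le_of_dvd h3 hd; omega, hj⟩
      · rw [e2, hv2]
        exact ⟨by omega, fun hd => by have := Nat.le_of_dvd (by omega) hd; omega, hj⟩
  omega

/-- `x` and `y` have a common factor of length `n`, up to reversal. -/
def HaveCommonFactor {L : Type u} (n : ℕ) (x y : ℕ → L) : Prop :=
  ∃ p q, (∀ i < n, x (p + i) = y (q + i)) ∨ ∀ i < n, x (p + i) = y (q + (n - 1 - i))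

theorem HaveCommonFactor.exists_card_eq {n : ℕ} {x y : ℕ → Fin 2} (h : HaveCommonFactor n x y) :
    ∃ p q, ((Finset.Ico p (p + n)).filter fun n => x n = 1).card =
      ((Finset.Ico q (q + n)).filter fun n => y n = 1).card := by
  obtain ⟨p, q, h | h⟩ := h
  · refine ⟨p, q, Finset.card_nbij' (fun i => q + (i - p)) (fun i => p + (i - q)) ?_ ?_ ?_ ?_⟩
    · intro i hi
      simp only [Finset.coe_filter, Finset.mem_Ico, Set.mem_ofPred_eq] at hi ⊢
      rw [← h _ (by omega), show p + (i - p) = i by omega]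
      exact ⟨by omega, hi.2⟩
    · intro i hi
      simp only [Finset.coe_filter, Finset.mem_Ico, Set.mem_ofPred_eq] at hi ⊢
      rw [h _ (by omega), show q + (i - q) = i by omega]
      exact ⟨by omega, hi.2⟩
    · intro i hi
      simp only [Finset.coe_filter, Finset.mem_Ico, Set.mem_ofPred_eq] at hi ⊢
      omega
    · intro i hi
      simp only [Finset.coe_filter, Finset.mem_Ico, Set.mem_ofPred_eq] at hi ⊢
      omega
  · refine ⟨p, q, Finset.card_nbij' (fun i => q + (n - 1 - (i - p)))
      (fun i => p + (n - 1 - (i - q))) ?_ ?_ ?_ ?_⟩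
    · intro i hi
      simp only [Finset.coe_filter, Finset.mem_Ico, Set.mem_ofPred_eq] at hi ⊢
      rw [← h _ (by omega), show p + (i - p) = i by omega]
      exact ⟨by omega, hi.2⟩
    · intro i hi
      simp only [Finset.coe_filter, Finset.mem_Ico, Set.mem_ofPred_eq] at hi ⊢
      rw [h _ (by omega), show q + (n - 1 - (n - 1 - (i - q))) = i by omega]
      exact ⟨by omega, hi.2⟩
    · intro i hi
      simp only [Finset.coe_filter, Finset.mem_Ico, Set.mem_ofPred_eq] at hi ⊢
      omega
    · intro i hi
      simp only [Finset.coe_filter, Finset.mem_Ico, Set.mem_ofPred_eq] at hi ⊢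
      omega

open Classical in
/-- The sequence `1, 0` followed by the indicator sequence of `d`. -/
noncomputable def codeSeq (d : Set ℕ) : ℕ → Fin 2
  | 0 => 1
  | 1 => 0
  | k + 2 => if k ∈ d then 1 else 0

/-- The Toeplitz word that codes the set `d`. -/
noncomputable def codeWord (d : Set ℕ) : ℕ → Fin 2 := toeplitzWord (codeSeq d)

theorem exists_not_haveCommonFactor_codeWord {d d' : Set ℕ} (h : d ≠ d') :
    ∃ n, 27 ≤ n ∧ ¬ HaveCommonFactor n (codeWord d) (codeWord d') := by
  classical
  have hex : ∃ k, ¬ (k ∈ d ↔ k ∈ d') := by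
    by_contra! hc
    exact h (Set.ext hc)
  let k := Nat.find hex
  have hk : ¬ (k ∈ d ↔ k ∈ d') := Nat.find_spec hex
  have hlt : ∀ i < k + 2, codeSeq d i = codeSeq d' i := by
    rintro (_ | _ | i) hi
    · rfl
    · rfl
    · have := not_not.1 (Nat.find_min hex (m := i) (by omega))
      simp only [codeSeq, this]
  refine ⟨3 ^ (k + 2 + 1), show 3 ^ 3 ≤ 3 ^ (k + 2 + 1) from pow_le_pow_right₀ (by norm_num) (by omega), ?_⟩
  intro hcf
  by_cases hd : k ∈ d
  · have hd' : k ∉ d' := by tauto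
    obtain ⟨p, q, e⟩ := hcf.exists_card_eq
    exact (card_ones_toeplitzWord_lt hlt (by simp [codeSeq, hd]) (by simp [codeSeq, hd']) p q).ne
      e.symm
  · have hd' : k ∈ d' := by tauto
    obtain ⟨p, q, e⟩ := hcf.exists_card_eq
    exact (card_ones_toeplitzWord_lt (fun i hi => (hlt i hi).symm) (by simp [codeSeq, hd'])
      (by simp [codeSeq, hd]) q p).ne e

theorem exists_letters_codeWord (d : Set ℕ) {n : ℕ} (hn : 27 ≤ n) (p : ℕ) :
    ∃ i₁ i₂ i₃ i₀, i₁ < i₂ ∧ i₂ < i₃ ∧ i₃ < n ∧ i₀ < n ∧ codeWord d (p + i₁) = 1 ∧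
      codeWord d (p + i₂) = 1 ∧ codeWord d (p + i₃) = 1 ∧ codeWord d (p + i₀) = 0 := by
  have h1 : ∀ m, ¬ 3 ∣ m + 1 → codeWord d m = 1 := fun m hm => by
    rw [codeWord, toeplitzWord, padicValNat.eq_zero_of_not_dvd hm, codeSeq]
  have h0 : ∀ m, 3 ∣ m + 1 → ¬ 9 ∣ m + 1 → codeWord d m = 0 := fun m hm hm' => by
    have e1 : 1 ≤ padicValNat 3 (m + 1) := one_le_padicValNat_of_dvd (by omega) hm
    have e2 : ¬ 2 ≤ padicValNat 3 (m + 1) := fun h =>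
      hm' ((padicValNat_dvd_iff_le (p := 3) (n := 2) (by omega)).2 h)
    rw [codeWord, toeplitzWord, show padicValNat 3 (m + 1) = 1 by omega, codeSeq]
  obtain ⟨s, hs, hs'⟩ : ∃ s < 9, 9 ∣ p + s :=
    ⟨(9 - p % 9) % 9, by omega, by omega⟩
  exact ⟨s, s + 1, s + 3, s + 2, by omega, by omega, by omega, by omega, h1 _ (by omega),
    h1 _ (by omega), h1 _ (by omega), h0 _ (by omega) (by omega)⟩

/-! ### Induced paths in lexicographical sums of labelled paths -/

/-- `f 0, …, f (n - 1)` is an induced path of `G`. -/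
def IsInducedPath {V : Type u} (G : SimpleGraph V) (n : ℕ) (f : ℕ → V) : Prop :=
  (∀ i < n, ∀ j < n, f i = f j → i = j) ∧
    ∀ i < n, ∀ j < n, (G.Adj (f i) (f j) ↔ i + 1 = j ∨ j + 1 = i)

theorem exists_isInducedPath {V : Type u} {G : SimpleGraph V} [Nonempty V] {n : ℕ}
    (φ : SimpleGraph.pathGraph n ↪g G) :
    ∃ f : ℕ → V, IsInducedPath G n f ∧ ∀ i, (h : i < n) → f i = φ ⟨i, h⟩ := by
  classical
  let f : ℕ → V := fun i => if h : i < n then φ ⟨i, h⟩ else Classical.arbitrary V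
  have hf : ∀ i, (h : i < n) → f i = φ ⟨i, h⟩ := fun i h => dif_pos h
  refine ⟨f, ⟨fun i hi j hj h => ?_, fun i hi j hj => ?_⟩, hf⟩
  · rw [hf i hi, hf j hj] at h
    exact congrArg Fin.val (φ.injective h)
  · rw [hf i hi, hf j hj, φ.map_adj_iff, SimpleGraph.pathGraph_adj]

theorem wordSum_sndProj_adj {x : ℕ → Fin 2} {p q : ℕ × ℕ} :
    (wordSum sndProj x).Adj p q ↔ (p.1 = q.1 ∧ (p.2 + 1 = q.2 ∨ q.2 + 1 = p.2)) ∨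
      (p.1 < q.1 ∧ x q.2 = 1) ∨ (q.1 < p.1 ∧ x p.2 = 1) := by
  simp [wordSum, lexSum, sndProj, SimpleGraph.hasse]

theorem exists_consecutive_of_ne {n : ℕ} (P : ℕ → Prop) {a b : ℕ} (ha : a < n) (hb : b < n)
    (hPa : P a) (hPb : ¬ P b) :
    ∃ s t, s < n ∧ t < n ∧ (s + 1 = t ∨ t + 1 = s) ∧ P s ∧ ¬ P t := by
  by_contra! hc
  have key : ∀ i, i < n → (P i ↔ P 0) := by
    intro i
    induction i with
    | zero => simp
    | succ i ih =>
      intro hi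
      rw [← ih (by omega)]
      exact ⟨fun h => hc (i + 1) i hi (by omega) (by omega) h,
        fun h => hc i (i + 1) (by omega) hi (by omega) h⟩
  exact hPb ((key b hb).2 ((key a ha).1 hPa))

/-- All but at most two vertices of an induced path lie in the last row that it meets. -/
theorem IsInducedPath.exists_row {x : ℕ → Fin 2} {n : ℕ} {f : ℕ → ℕ × ℕ}
    (hf : IsInducedPath (wordSum sndProj x) n f) :
    ∃ r, ∀ a < n, ∀ b < n, ∀ c < n, a < b → b < c →
      (f a).1 = r ∨ (f b).1 = r ∨ (f c).1 = r := by
  rcases Nat.eq_zero_or_pos n with rfl | hn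
  · exact ⟨0, by simp⟩
  obtain ⟨m, hm, hmax⟩ := Finset.exists_max_image (Finset.range n) (fun i => (f i).1)
    ⟨0, Finset.mem_range.2 hn⟩
  simp only [Finset.mem_range] at hm hmax
  refine ⟨(f m).1, fun a ha b hb c hc hab hbc => ?_⟩
  by_contra! hne
  obtain ⟨s, t, hs, ht, hst, hPs, hPt⟩ := exists_consecutive_of_ne
    (fun i => (f i).1 = (f m).1) hm ha rfl hne.1
  have h1 := (hf.2 t ht s hs).2 (by omega)
  have hlt : (f t).1 < (f s).1 := by have := hmax t ht; omega
  have hx : x (f s).2 = 1 := by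
    rcases wordSum_sndProj_adj.1 h1 with h | h | h
    · omega
    · exact h.2
    · omega
  have hadj : ∀ i < n, (f i).1 ≠ (f m).1 → i + 1 = s ∨ s + 1 = i := fun i hi h =>
    (hf.2 i hi s hs).1 (wordSum_sndProj_adj.2 (.inr (.inl ⟨by have := hmax i hi; omega, hx⟩)))
  have := hadj a ha hne.1
  have := hadj b hb hne.2.1
  have := hadj c hc hne.2.2
  omega

theorem eq_add_or_add_eq_of_step {n : ℕ} {f : ℕ → ℕ}
    (hinj : ∀ i < n, ∀ j < n, f i = f j → i = j)
    (hstep : ∀ i, i + 1 < n → f i + 1 = f (i + 1) ∨ f (i + 1) + 1 = f i) :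
    (∀ i < n, f i = f 0 + i) ∨ ∀ i < n, f i + i = f 0 := by
  have hinj' : ∀ i, i + 2 < n → f i ≠ f (i + 2) := fun i hi h => by
    have := hinj i (by omega) (i + 2) hi h
    omega
  by_cases h01 : f 0 + 1 = f 1
  · left
    have key : ∀ i, i + 1 < n → f i + 1 = f (i + 1) := by
      intro i
      induction i with
      | zero => exact fun _ => h01
      | succ i ih =>
        intro hi
        have := ih (by omega)
        have := hinj' i hi
        have := hstep (i + 1) hi
        rw [show i + 1 + 1 = i + 2 from rfl] at *
        omega
    intro i
    induction i with
    | zero => simp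
    | succ i ih => intro hi; have := ih (by omega); have := key i hi; omega
  · right
    have key : ∀ i, i + 1 < n → f (i + 1) + 1 = f i := by
      intro i
      induction i with
      | zero => exact fun hi => (hstep 0 hi).resolve_left h01
      | succ i ih =>
        intro hi
        have := ih (by omega)
        have := hinj' i hi
        have := hstep (i + 1) hi
        rw [show i + 1 + 1 = i + 2 from rfl] at *
        omega
    intro i
    induction i with
    | zero => simp
    | succ i ih => intro hi; have := ih (by omega); have := key i hi; omega

/-- An induced path with `3 * n` vertices contains a subpath with `n` vertices that is an interval
of a row, traversed in one of the two directions. -/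
theorem IsInducedPath.exists_interval {x : ℕ → Fin 2} {n : ℕ} {f : ℕ → ℕ × ℕ}
    (hf : IsInducedPath (wordSum sndProj x) (3 * n) f) :
    ∃ r s c, s + n ≤ 3 * n ∧ ((∀ i < n, f (s + i) = (r, c + i)) ∨
      ∀ i < n, f (s + i) = (r, c + (n - 1 - i))) := by
  rcases Nat.eq_zero_or_pos n with rfl | hn
  · exact ⟨0, 0, 0, by simp⟩
  obtain ⟨r, hr⟩ := hf.exists_row
  obtain ⟨s, hs, hrow⟩ : ∃ s, s + n ≤ 3 * n ∧ ∀ i < n, (f (s + i)).1 = r := by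
    by_contra! hc
    obtain ⟨i, hi, h1⟩ := hc 0 (by omega)
    obtain ⟨j, hj, h2⟩ := hc n (by omega)
    obtain ⟨k, hk, h3⟩ := hc (n + n) (by omega)
    rcases hr (0 + i) (by omega) (n + j) (by omega) (n + n + k) (by omega) (by omega) (by omega)
      with h | h | h <;> contradiction
  have hstep : ∀ i, i + 1 < n → (f (s + i)).2 + 1 = (f (s + (i + 1))).2 ∨
      (f (s + (i + 1))).2 + 1 = (f (s + i)).2 := by
    intro i hi
    have h := (hf.2 (s + i) (by omega) (s + (i + 1)) (by omega)).2 (by omega)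
    have h1 := hrow i (by omega)
    have h2 := hrow (i + 1) hi
    rcases wordSum_sndProj_adj.1 h with h | h | h
    · exact h.2
    · omega
    · omega
  rcases eq_add_or_add_eq_of_step (f := fun i => (f (s + i)).2) (n := n) (fun i hi j hj h => by
    have := hf.1 (s + i) (by omega) (s + j) (by omega)
      (Prod.ext ((hrow i hi).trans (hrow j hj).symm) h)
    omega) hstep with h | h
  · exact ⟨r, s, (f (s + 0)).2, hs, .inl fun i hi => Prod.ext (hrow i hi) (h i hi)⟩
  · refine ⟨r, s, (f (s + (n - 1))).2, hs, .inr fun i hi => Prod.ext (hrow i hi) ?_⟩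
    have h1 := h i hi
    have h2 := h (n - 1) (by omega)
    dsimp only at h1 h2 ⊢
    omega

/-! ### Graphs with unbounded paths -/

theorem HasUnboundedPaths.exists_interval {V : Type u} {H : SimpleGraph V}
    (hH : HasUnboundedPaths H) {x : ℕ → Fin 2} (φ : H ↪g wordSum sndProj x) (n : ℕ) :
    ∃ r c, ∀ i < n, (r, c + i) ∈ Set.range φ := by
  obtain ⟨g⟩ := hH (3 * n)
  obtain ⟨f, hf, hfg⟩ := exists_isInducedPath (g.trans φ)
  have hmem : ∀ i < 3 * n, f i ∈ Set.range φ := fun i hi => ⟨g ⟨i, hi⟩, (hfg i hi).symm⟩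
  obtain ⟨r, s, c, hs, h | h⟩ := hf.exists_interval
  · exact ⟨r, c, fun i hi => h i hi ▸ hmem _ (by omega)⟩
  · refine ⟨r, c, fun i hi => ?_⟩
    have := h (n - 1 - i) (by omega)
    rw [show n - 1 - (n - 1 - i) = i by omega] at this
    exact this ▸ hmem _ (by omega)

/-- The triangular family of intervals `[0, n]`. -/
def triangle (n : ℕ) : Set ℕ := Set.Iic n

theorem isUnboundedIntervalFamily_triangle : IsUnboundedIntervalFamily triangle :=
  ⟨fun _ => Set.ordConnected_Iic, fun n => Set.finite_Iic n, fun k => ⟨k, by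
    rw [triangle, ← Finset.coe_Iic, Set.ncard_coe_finset, Nat.card_Iic]; omega⟩⟩

/-- The inclusion of `wordSumOn` in `wordSum`. -/
def wordSumOnEmbedding {L : Type u} (star : L → L → Fin 2) (x : ℕ → L) (J : ℕ → Set ℕ) :
    wordSumOn star x J ↪g wordSum star x :=
  SimpleGraph.Embedding.induce _

theorem hasUnboundedPaths_wordSumOn_triangle (x : ℕ → Fin 2) :
    HasUnboundedPaths (wordSumOn sndProj x triangle) := fun n =>
  ⟨{  toFun := fun i => ⟨(n, i), i.2.le⟩
      inj' := fun i j h => Fin.ext (congrArg (fun p => p.1.2) h)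
      map_rel_iff' := by
        intro i j
        rw [SimpleGraph.pathGraph_adj]
        refine (wordSum_sndProj_adj (x := x) (p := (n, i)) (q := (n, j))).trans ?_
        simp }⟩

theorem nonempty_embedding_of_hasUnboundedPaths {x : ℕ → Fin 2} (hx : UniformlyRecurrent x)
    {V : Type u} {H : SimpleGraph V} (hH : HasUnboundedPaths H)
    (φ : H ↪g wordSumOn sndProj x triangle) :
    Nonempty (wordSumOn sndProj x triangle ↪g H) := by
  have hrow : ∀ n, ∃ᶠ r in Filter.atTop, ∃ c, ∀ i < n + 1, x (c + i) = x i ∧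
      ∃ v, (φ v).1 = (r, c + i) := by
    intro n
    rw [Filter.frequently_atTop]
    intro b
    obtain ⟨m, hm⟩ := hx (n + 1)
    obtain ⟨r, c, hrc⟩ := hH.exists_interval (φ.trans (wordSumOnEmbedding sndProj x triangle))
      (m + (b + 1))
    have hrc' : ∀ i < m + (b + 1), ∃ v, (φ v).1 = (r, c + i) := hrc
    refine ⟨r, ?_, ?_⟩
    · obtain ⟨v, hv⟩ := hrc' (m + b) (by omega)
      have h : (φ v).1.2 ≤ (φ v).1.1 := (φ v).2
      rw [hv] at h
      dsimp only at h
      omega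
    · obtain ⟨s, hs, hs', hxs⟩ := hm 0 c
      refine ⟨s, fun i hi => ⟨by simpa using hxs i hi, ?_⟩⟩
      obtain ⟨v, hv⟩ := hrc' (s + i - c) (by omega)
      exact ⟨v, by rw [hv, show c + (s + i - c) = s + i by omega]⟩
  obtain ⟨ρ, hρ, hc⟩ := Filter.extraction_forall_of_frequently hrow
  choose c hc using hc
  choose g hg using fun p : {p : ℕ × ℕ | p.2 ∈ triangle p.1} =>
    (hc p.1.1 p.1.2 (Nat.lt_succ_of_le p.2)).2
  have hlab := fun p : {p : ℕ × ℕ | p.2 ∈ triangle p.1} =>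
    (hc p.1.1 p.1.2 (Nat.lt_succ_of_le p.2)).1
  refine ⟨⟨⟨g, fun p q h => ?_⟩, fun {p q} => ?_⟩⟩
  · have h1 := hg p
    rw [h, hg q, Prod.mk.injEq] at h1
    have h2 := hρ.injective h1.1
    rw [h2] at h1
    exact Subtype.ext (Prod.ext h2.symm (by omega))
  · rw [← φ.map_adj_iff]
    change (wordSum sndProj x).Adj (φ (g p)).1 (φ (g q)).1 ↔ (wordSum sndProj x).Adj p.1 q.1
    rw [hg, hg, wordSum_sndProj_adj, wordSum_sndProj_adj]
    dsimp only
    rw [hlab p, hlab q, hρ.lt_iff_lt, hρ.lt_iff_lt, hρ.injective.eq_iff]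
    refine or_congr (and_congr_right fun h => ?_) Iff.rfl
    rw [h]
    omega

theorem isPathMinimal_of_iso {x : ℕ → Fin 2} (hx : UniformlyRecurrent x) {V : Type u}
    {G : SimpleGraph V} (e : G ≃g wordSumOn sndProj x triangle) : IsPathMinimal G := by
  refine ⟨fun n => ?_, fun A hA => ?_⟩
  · obtain ⟨f⟩ := hasUnboundedPaths_wordSumOn_triangle x n
    exact ⟨f.trans e.symm.toEmbedding⟩
  · obtain ⟨f⟩ := nonempty_embedding_of_hasUnboundedPaths hx hA
      ((SimpleGraph.Embedding.induce A).trans e.toEmbedding)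
    exact ⟨e.toEmbedding.trans f⟩

/-! ### Primality -/

theorem not_isPrimeGraph_of_embedding {x : ℕ → Fin 2} {J : ℕ → Set ℕ} (hJ : ∀ n, (J n).Finite)
    {V : Type u} [Infinite V] {H : SimpleGraph V} (φ : H ↪g wordSumOn sndProj x J) :
    ¬ IsPrimeGraph H := by
  rintro ⟨-, hprime⟩
  obtain ⟨a⟩ : Nonempty V := inferInstance
  obtain ⟨b, hb⟩ := exists_ne a
  let N := max (φ a).1.1 (φ b).1.1
  let A : Set V := {v | (φ v).1.1 ≤ N}
  have haA : a ∈ A := show (φ a).1.1 ≤ N from le_max_left _ _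
  have hbA : b ∈ A := show (φ b).1.1 ≤ N from le_max_right _ _
  have hmod : IsModuleSet H A := by
    intro v hv
    have hv : N < (φ v).1.1 := not_le.1 hv
    have hadj : ∀ w ∈ A, (H.Adj v w ↔ x (φ v).1.2 = 1) := by
      intro w hw
      have hw : (φ w).1.1 ≤ N := hw
      rw [← φ.map_adj_iff]
      refine (wordSum_sndProj_adj (x := x) (p := (φ v).1) (q := (φ w).1)).trans ?_
      constructor
      · rintro (h | h | h)
        · omega
        · omega
        · exact h.2
      · exact fun h => .inr (.inr ⟨by omega, h⟩)
    by_cases h : x (φ v).1.2 = 1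
    · exact .inl fun w hw => (hadj w hw).2 h
    · exact .inr fun w hw => fun h' => h ((hadj w hw).1 h')
  rcases hprime A hmod with h | ⟨c, h⟩ | h
  · rw [h] at haA; exact haA
  · rw [h] at haA hbA
    exact hb (hbA.trans haA.symm)
  · have hfin : (⋃ n ∈ Set.Iic N, Prod.mk n '' J n).Finite :=
      (Set.finite_Iic N).biUnion fun n _ => (hJ n).image _
    refine Set.infinite_range_of_injective
      (Subtype.val_injective.comp φ.injective) (hfin.subset ?_)
    rintro _ ⟨v, rfl⟩
    have hv : v ∈ A := h ▸ Set.mem_univ v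
    exact Set.mem_biUnion (show (φ v).1.1 ∈ Set.Iic N from hv) ⟨(φ v).1.2, (φ v).2, rfl⟩

/-! ### Comparison of ages -/

theorem embedding_of_age_subset {V : Type u} {W : Type v} {G : SimpleGraph V} {G' : SimpleGraph W}
    (h : age G ⊆ age G') {X : Type w} [Finite X] {K : SimpleGraph X} (f : K ↪g G) :
    Nonempty (K ↪g G') := by
  have := Fintype.ofFinite X
  let e := Fintype.equivFin X
  let i : K ≃g K.comap e.symm := (SimpleGraph.Iso.comap e.symm K).symm
  obtain ⟨g⟩ := @h ⟨_, K.comap e.symm⟩ ⟨i.symm.toEmbedding.trans f⟩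
  exact ⟨i.toEmbedding.trans g⟩

/-- If every factor of `x` of length `n` has three ones and a zero, then inclusion of the ages
produces a common factor of length `n`, up to reversal. -/
theorem haveCommonFactor_of_age_subset {x y : ℕ → Fin 2} {n : ℕ}
    (hx : ∀ p, ∃ i₁ i₂ i₃ i₀, i₁ < i₂ ∧ i₂ < i₃ ∧ i₃ < n ∧ i₀ < n ∧ x (p + i₁) = 1 ∧
      x (p + i₂) = 1 ∧ x (p + i₃) = 1 ∧ x (p + i₀) = 0)
    {V : Type u} {H : SimpleGraph V} (φ : H ↪g wordSum sndProj y)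
    (hage : age (wordSumOn sndProj x triangle) ⊆ age H) : HaveCommonFactor n x y := by
  have hn : 0 < n := by obtain ⟨_, _, _, _, h⟩ := hx 0; omega
  let k : Option (Fin (3 * n)) → {p : ℕ × ℕ | p.2 ∈ triangle p.1}
    | none => ⟨(0, 0), le_refl 0⟩
    | some i => ⟨(3 * n, i), i.2.le⟩
  have hk : Function.Injective k := by
    intro a b h
    have h1 := congrArg (fun p => p.1.1) h
    have h2 := congrArg (fun p => p.1.2) h
    rcases a with _ | i <;> rcases b with _ | j <;> dsimp only [k] at h1 h2
    · rfl
    · omega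
    · omega
    · rw [Fin.ext h2]
  obtain ⟨g⟩ := embedding_of_age_subset hage
    (SimpleGraph.Embedding.comap ⟨k, hk⟩ (wordSumOn sndProj x triangle))
  have hadj : ∀ a b, (wordSum sndProj y).Adj (φ (g a)) (φ (g b)) ↔
      (wordSum sndProj x).Adj (k a).1 (k b).1 := fun a b => by
    rw [φ.map_adj_iff, g.map_adj_iff]; rfl
  let f : ℕ → ℕ × ℕ := fun i => if h : i < 3 * n then φ (g (some ⟨i, h⟩)) else 0
  have hfi : ∀ i, (h : i < 3 * n) → f i = φ (g (some ⟨i, h⟩)) := fun i h => dif_pos h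
  have hf : IsInducedPath (wordSum sndProj y) (3 * n) f := by
    refine ⟨fun i hi j hj h => ?_, fun i hi j hj => ?_⟩
    · rw [hfi i hi, hfi j hj] at h
      simpa using g.injective (φ.injective h)
    · rw [hfi i hi, hfi j hj, hadj, wordSum_sndProj_adj]
      simp [k]
  obtain ⟨z, hz⟩ : ∃ z, z = φ (g none) := ⟨_, rfl⟩
  have hzf : ∀ i < 3 * n, ((wordSum sndProj y).Adj z (f i) ↔ x i = 1) := by
    intro i hi
    rw [hz, hfi i hi, hadj, wordSum_sndProj_adj]
    simp [k, hn, hn.ne']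
  obtain ⟨r, s, c, hs, hrow⟩ := hf.exists_interval
  have hr : ∀ i < n, (f (s + i)).1 = r := fun i hi => by
    rcases hrow with h | h <;> rw [h i hi]
  obtain ⟨i₁, i₂, i₃, i₀, h12, h23, h3, h0, x1, x2, x3, x0⟩ := hx s
  have hz1 := (hzf _ (by omega)).2 x1
  have hz2 := (hzf _ (by omega)).2 x2
  have hz3 := (hzf _ (by omega)).2 x3
  have hz0 : ¬ (wordSum sndProj y).Adj z (f (s + i₀)) := fun h => by
    have := (hzf _ (by omega)).1 h
    rw [x0] at this
    exact zero_ne_one this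
  rw [wordSum_sndProj_adj, hr _ (by omega)] at hz1 hz2 hz3 hz0
  rcases lt_trichotomy z.1 r with h | h | h
  · have hlab : ∀ i < n, x (s + i) = y (f (s + i)).2 := by
      intro i hi
      have h1 := hzf (s + i) (by omega)
      rw [wordSum_sndProj_adj, hr _ hi] at h1
      have h2 : y (f (s + i)).2 = 1 ↔ x (s + i) = 1 := by
        rw [← h1]
        constructor
        · exact fun h' => .inr (.inl ⟨h, h'⟩)
        · rintro (h' | h' | h')
          · omega
          · exact h'.2
          · omega
      revert h2
      generalize x (s + i) = u
      generalize y (f (s + i)).2 = v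
      revert u v
      decide
    refine ⟨s, c, hrow.imp (fun h i hi => ?_) (fun h i hi => ?_)⟩ <;> rw [hlab i hi, h i hi]
  · have e1 : z.2 + 1 = (f (s + i₁)).2 ∨ (f (s + i₁)).2 + 1 = z.2 := by omega
    have e2 : z.2 + 1 = (f (s + i₂)).2 ∨ (f (s + i₂)).2 + 1 = z.2 := by omega
    have e3 : z.2 + 1 = (f (s + i₃)).2 ∨ (f (s + i₃)).2 + 1 = z.2 := by omega
    rcases hrow with h' | h' <;> rw [h' _ (by omega)] at e1 e2 e3 <;> dsimp only at e1 e2 e3 <;>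
      omega
  · exact absurd (.inr (.inr ⟨h, by
      rcases hz1 with h' | h' | h'
      · omega
      · omega
      · exact h'.2⟩)) hz0

/-! ### Well-quasi-ordered ages -/

/-- The factor of `x` of length `p.2` at position `p.1` occurs inside the factor of length `q.2`
at position `q.1`. -/
def FactorLE {L : Type u} (x : ℕ → L) (p q : ℕ × ℕ) : Prop :=
  ∃ s, s + p.2 ≤ q.2 ∧ ∀ i < p.2, x (q.1 + s + i) = x (p.1 + i)

instance FactorLE.instIsPreorder {L : Type u} (x : ℕ → L) : IsPreorder (ℕ × ℕ) (FactorLE x) where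
  refl p := ⟨0, by simp⟩
  trans p q r := by
    rintro ⟨s, hs, h⟩ ⟨t, ht, h'⟩
    refine ⟨t + s, by omega, fun i hi => ?_⟩
    rw [← h i hi, add_assoc q.1, ← h' (s + i) (by omega)]
    congr 1
    omega

theorem UniformlyRecurrent.wellQuasiOrdered_factorLE {L : Type u} [Finite L] {x : ℕ → L}
    (hx : UniformlyRecurrent x) : WellQuasiOrdered (FactorLE x) := by
  intro f
  obtain ⟨m, hm⟩ := hx (f 0).2
  by_cases h : ∃ n, 0 < n ∧ m ≤ (f n).2
  · obtain ⟨n, hn, hmn⟩ := h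
    obtain ⟨r, hr, hr', h⟩ := hm (f 0).1 (f n).1
    refine ⟨0, n, hn, r - (f n).1, by omega, fun i hi => ?_⟩
    rw [← h i hi]
    congr 1
    omega
  · push Not at h
    let F : ℕ → Σ k : Fin (m + 1), Fin k → L := fun n =>
      ⟨⟨min (f (n + 1)).2 m, by omega⟩, fun i => x ((f (n + 1)).1 + i)⟩
    obtain ⟨a, b, hab, hF⟩ := Finite.exists_ne_map_eq_of_infinite F
    have key : ∀ a b, F a = F b → FactorLE x (f (a + 1)) (f (b + 1)) := by
      intro a b hF
      have ha := h (a + 1) (by omega)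
      have hb := h (b + 1) (by omega)
      have hlen : (f (a + 1)).2 = (f (b + 1)).2 := by
        have := congrArg (fun z => (z.1 : ℕ)) hF
        simp only [F] at this
        omega
      refine ⟨0, by omega, fun i hi => ?_⟩
      have h1 : ∀ z w : Σ k : Fin (m + 1), Fin k → L, z = w → ∀ i : ℕ, ∀ (h : i < z.1) (h' : i < w.1),
          z.2 ⟨i, h⟩ = w.2 ⟨i, h'⟩ := by
        rintro z _ rfl i _ _; rfl
      exact (h1 _ _ hF i (lt_min hi (by omega)) (lt_min (by omega) (by omega))).symm
    rcases lt_or_gt_of_ne hab with hab | hab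
    · exact ⟨a + 1, b + 1, by omega, key a b hF⟩
    · exact ⟨b + 1, a + 1, by omega, key b a hF.symm⟩

instance sublistForall₂_isPreorder {α : Type u} (r : α → α → Prop) [IsPreorder α r] :
    IsPreorder (List α) (List.SublistForall₂ r) where

theorem WellQuasiOrdered.sublistForall₂ {α : Type u} {r : α → α → Prop} [IsPreorder α r]
    (h : WellQuasiOrdered r) : WellQuasiOrdered (List.SublistForall₂ r) := by
  have := Set.PartiallyWellOrderedOn.partiallyWellOrderedOn_sublistForall₂ r
    (Set.partiallyWellOrderedOn_univ_iff.2 h)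
  simpa [Set.partiallyWellOrderedOn_univ_iff] using this

/-- `k` lies in one of the intervals `[p.1, p.1 + p.2)`, `p ∈ l`. -/
def InIntervals (l : List (ℕ × ℕ)) (k : ℕ) : Prop := ∃ p ∈ l, p.1 ≤ k ∧ k < p.1 + p.2

/-- The intervals in the list are listed from right to left and are pairwise non-adjacent. -/
def Separated (l : List (ℕ × ℕ)) : Prop := l.Pairwise fun p q => q.1 + q.2 < p.1

theorem Separated.add_one_lt {p : ℕ × ℕ} {l : List (ℕ × ℕ)} (h : Separated (p :: l)) {k : ℕ}
    (hk : InIntervals l k) : k + 1 < p.1 := by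
  obtain ⟨q, hq, h1, h2⟩ := hk
  have := (List.pairwise_cons.1 h).1 q hq
  omega

theorem inIntervals_cons {p : ℕ × ℕ} {l : List (ℕ × ℕ)} {k : ℕ} :
    InIntervals (p :: l) k ↔ (p.1 ≤ k ∧ k < p.1 + p.2) ∨ InIntervals l k := by
  simp [InIntervals]

theorem exists_separated (S : Finset ℕ) :
    ∃ l, Separated l ∧ (∀ p ∈ l, 0 < p.2) ∧ ∀ k, k ∈ S ↔ InIntervals l k := by
  induction S using Finset.induction_on_max with
  | empty => exact ⟨[], List.Pairwise.nil, by simp, by simp [InIntervals]⟩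
  | insert m S hm ih =>
    obtain ⟨l, hl, hpos, hmem⟩ := ih
    rcases l with - | ⟨⟨a, n⟩, t⟩
    · refine ⟨[(m, 1)], List.pairwise_singleton _ _, by simp, fun k => ?_⟩
      rw [Finset.mem_insert, hmem, inIntervals_cons]
      refine or_congr ?_ Iff.rfl
      dsimp only
      omega
    · have hn : 0 < n := hpos (a, n) (by simp)
      have ham : a + (n - 1) < m :=
        hm _ ((hmem _).2 (inIntervals_cons.2 (.inl ⟨by dsimp only; omega, by dsimp only; omega⟩)))
      obtain ⟨h1, h2⟩ := List.pairwise_cons.1 hl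
      by_cases h : a + n = m
      · refine ⟨(a, n + 1) :: t, List.pairwise_cons.2 ⟨h1, h2⟩, ?_, fun k => ?_⟩
        · intro p hp
          rcases List.mem_cons.1 hp with rfl | hp
          · exact Nat.succ_pos n
          · exact hpos p (List.mem_cons_of_mem _ hp)
        · rw [Finset.mem_insert, hmem, inIntervals_cons, inIntervals_cons, ← or_assoc]
          refine or_congr ?_ Iff.rfl
          dsimp only
          omega
      · refine ⟨(m, 1) :: (a, n) :: t, List.pairwise_cons.2 ⟨?_, hl⟩, ?_, fun k => ?_⟩
        · intro q hq
          rcases List.mem_cons.1 hq with rfl | hq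
          · dsimp only; omega
          · have := h1 q hq
            dsimp only at this ⊢
            omega
        · intro p hp
          rcases List.mem_cons.1 hp with rfl | hp
          · exact Nat.one_pos
          · exact hpos p hp
        · rw [Finset.mem_insert, hmem, inIntervals_cons (p := (m, 1))]
          refine or_congr ?_ Iff.rfl
          dsimp only
          omega

theorem exists_map_of_sublistForall₂_factorLE {L : Type u} {x : ℕ → L} {l l' : List (ℕ × ℕ)}
    (h : List.SublistForall₂ (FactorLE x) l l') (hl : Separated l) (hl' : Separated l') :
    ∃ g : ℕ → ℕ, ∀ k, InIntervals l k → InIntervals l' (g k) ∧ x (g k) = x k ∧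
      ∀ k', InIntervals l k' → (g k = g k' → k = k') ∧
        (g k + 1 = g k' ∨ g k' + 1 = g k ↔ k + 1 = k' ∨ k' + 1 = k) := by
  induction h with
  | nil => exact ⟨id, fun k hk => by simp [InIntervals] at hk⟩
  | @cons a b l l' hab _ ih =>
    obtain ⟨g, hg⟩ := ih (List.pairwise_cons.1 hl).2 (List.pairwise_cons.1 hl').2
    obtain ⟨s, hs, hx⟩ := hab
    let g' : ℕ → ℕ := fun k => if a.1 ≤ k then b.1 + s + (k - a.1) else g k
    have hhead : ∀ k, a.1 ≤ k → g' k = b.1 + s + (k - a.1) := fun k hk => if_pos hk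
    have htail : ∀ k, InIntervals l k → g' k = g k := fun k hk =>
      if_neg (by have := hl.add_one_lt hk; omega)
    refine ⟨g', fun k hk => ?_⟩
    rcases inIntervals_cons.1 hk with hk | hk
    · rw [hhead k hk.1]
      refine ⟨inIntervals_cons.2 (.inl (by omega)), ?_, fun k' hk' => ?_⟩
      · rw [hx _ (by omega)]
        congr 1
        omega
      · rcases inIntervals_cons.1 hk' with hk' | hk'
        · rw [hhead k' hk'.1]
          omega
        · have h1 := hl.add_one_lt hk'
          have h2 := hl'.add_one_lt (hg k' hk').1
          rw [htail k' hk']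
          omega
    · rw [htail k hk]
      refine ⟨inIntervals_cons.2 (.inr (hg k hk).1), (hg k hk).2.1, fun k' hk' => ?_⟩
      rcases inIntervals_cons.1 hk' with hk' | hk'
      · have h1 := hl.add_one_lt hk
        have h2 := hl'.add_one_lt (hg k hk).1
        rw [hhead k' hk'.1]
        omega
      · rw [htail k' hk']
        exact (hg k hk).2.2 k' hk'
  | cons_right _ ih =>
    obtain ⟨g, hg⟩ := ih hl (List.pairwise_cons.1 hl').2
    exact ⟨g, fun k hk => ⟨inIntervals_cons.2 (.inr (hg k hk).1), (hg k hk).2⟩⟩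

theorem exists_strictMono_of_sublistForall₂ {α : Type u} {r : α → α → Prop} {l l' : List α}
    (h : List.SublistForall₂ r l l') :
    ∃ f : ℕ → ℕ, StrictMono f ∧ ∀ i a, l[i]? = some a → ∃ b, l'[f i]? = some b ∧ r a b := by
  induction h with
  | nil => exact ⟨id, strictMono_id, by simp⟩
  | @cons a b l l' hab _ ih =>
    obtain ⟨f, hf, h⟩ := ih
    refine ⟨fun i => Nat.casesOn i 0 fun i => f i + 1, ?_, ?_⟩
    · refine strictMono_nat_of_lt_succ fun i => ?_
      cases i with
      | zero => exact Nat.succ_pos _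
      | succ i => exact Nat.succ_lt_succ (hf (Nat.lt_succ_self i))
    · rintro (_ | i) c hc
      · simp only [List.getElem?_cons_zero, Option.some.injEq] at hc
        exact ⟨b, by simp, hc ▸ hab⟩
      · rw [List.getElem?_cons_succ] at hc
        simpa using h i c hc
  | cons_right _ ih =>
    obtain ⟨f, hf, h⟩ := ih
    exact ⟨fun i => f i + 1, fun i j hij => Nat.succ_lt_succ (hf hij), fun i a ha => by
      simpa using h i a ha⟩

/-- The list of the maximal intervals of a finite set of natural numbers. -/
noncomputable def intervalList (S : Finset ℕ) : List (ℕ × ℕ) := (exists_separated S).choose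

theorem separated_intervalList (S : Finset ℕ) : Separated (intervalList S) :=
  (exists_separated S).choose_spec.1

theorem mem_iff_inIntervals_intervalList {S : Finset ℕ} {k : ℕ} :
    k ∈ S ↔ InIntervals (intervalList S) k :=
  (exists_separated S).choose_spec.2.2 k

/-- The `n`-th row of a finite subset of `ℕ × ℕ`. -/
def row (T : Finset (ℕ × ℕ)) (n : ℕ) : Finset ℕ := (T.filter fun p => p.1 = n).image Prod.snd

theorem mem_row {T : Finset (ℕ × ℕ)} {n k : ℕ} : k ∈ row T n ↔ (n, k) ∈ T := by
  simp [row]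

/-- The list of the interval lists of the rows of a finite subset of `ℕ × ℕ`. -/
noncomputable def rowList (T : Finset (ℕ × ℕ)) : List (List (ℕ × ℕ)) :=
  (List.range (T.sup Prod.fst + 1)).map fun n => intervalList (row T n)

theorem rowList_getElem?_of_mem {T : Finset (ℕ × ℕ)} {p : ℕ × ℕ} (hp : p ∈ T) :
    (rowList T)[p.1]? = some (intervalList (row T p.1)) := by
  have : p.1 < T.sup Prod.fst + 1 := Nat.lt_succ_of_le (Finset.le_sup (f := Prod.fst) hp)
  simp [rowList, List.getElem?_range this]

theorem eq_of_rowList_getElem? {T : Finset (ℕ × ℕ)} {n : ℕ} {l : List (ℕ × ℕ)}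
    (h : (rowList T)[n]? = some l) : l = intervalList (row T n) := by
  simp only [rowList, List.getElem?_map, Option.map_eq_some_iff] at h
  obtain ⟨m, hm, rfl⟩ := h
  obtain ⟨_, rfl⟩ := List.getElem?_eq_some_iff.1 hm
  simp

theorem exists_map_of_rowList {x : ℕ → Fin 2} {T T' : Finset (ℕ × ℕ)}
    (h : List.SublistForall₂ (List.SublistForall₂ (FactorLE x)) (rowList T) (rowList T')) :
    ∃ g : ℕ × ℕ → ℕ × ℕ, ∀ p ∈ T, g p ∈ T' ∧ ∀ q ∈ T, (g p = g q → p = q) ∧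
      ((wordSum sndProj x).Adj (g p) (g q) ↔ (wordSum sndProj x).Adj p q) := by
  obtain ⟨f, hf, h⟩ := exists_strictMono_of_sublistForall₂ h
  have hrow : ∀ n, ∃ g : ℕ → ℕ, ∀ k, (n, k) ∈ T → (f n, g k) ∈ T' ∧ x (g k) = x k ∧
      ∀ k', (n, k') ∈ T → (g k = g k' → k = k') ∧
        (g k + 1 = g k' ∨ g k' + 1 = g k ↔ k + 1 = k' ∨ k' + 1 = k) := by
    intro n
    by_cases hn : ∃ k, (n, k) ∈ T
    · obtain ⟨k, hk⟩ := hn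
      obtain ⟨l, hl, hle⟩ := h n _ (rowList_getElem?_of_mem hk)
      rw [eq_of_rowList_getElem? hl] at hle
      simpa only [← mem_iff_inIntervals_intervalList, mem_row] using
        exists_map_of_sublistForall₂_factorLE hle (separated_intervalList _)
          (separated_intervalList _)
    · exact ⟨id, fun k hk => (hn ⟨k, hk⟩).elim⟩
  choose g hg using hrow
  refine ⟨fun p => (f p.1, g p.1 p.2), fun p hp => ⟨(hg p.1 p.2 hp).1, fun q hq => ⟨?_, ?_⟩⟩⟩
  · intro h
    rw [Prod.mk.injEq] at h
    have h1 := hf.injective h.1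
    have h2 := h.2
    rw [← h1] at h2
    exact Prod.ext h1 (((hg p.1 p.2 hp).2.2 q.2 (by rw [h1]; exact hq)).1 h2)
  · rw [wordSum_sndProj_adj, wordSum_sndProj_adj]
    dsimp only
    rw [hf.lt_iff_lt, hf.lt_iff_lt, hf.injective.eq_iff, (hg p.1 p.2 hp).2.1,
      (hg q.1 q.2 hq).2.1]
    refine or_congr (and_congr_right fun h1 => ?_) Iff.rfl
    rw [← h1]
    exact ((hg p.1 p.2 hp).2.2 q.2 (by rw [h1]; exact hq)).2

theorem hasWqoAge_of_embedding {x : ℕ → Fin 2} (hx : UniformlyRecurrent x) {V : Type u}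
    {G : SimpleGraph V} (φ : G ↪g wordSum sndProj x) : HasWqoAge G := by
  classical
  have hwqo := WellQuasiOrdered.sublistForall₂ (r := List.SublistForall₂ (FactorLE x))
    (WellQuasiOrdered.sublistForall₂ hx.wellQuasiOrdered_factorLE)
  refine Set.partiallyWellOrderedOn_iff_exists_lt.2 fun A hA => ?_
  have ψ : ∀ n, (A n).2 ↪g G := fun n => (hA n : Nonempty _).some
  let T : ℕ → Finset (ℕ × ℕ) := fun n => Finset.univ.image fun i => φ (ψ n i)
  have hT : ∀ n i, φ (ψ n i) ∈ T n := fun n i => Finset.mem_image_of_mem _ (Finset.mem_univ i)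
  obtain ⟨m, n, hmn, h⟩ := hwqo fun n => rowList (T n)
  obtain ⟨g, hg⟩ := exists_map_of_rowList h
  have hpre : ∀ i, ∃ j, φ (ψ n j) = g (φ (ψ m i)) := fun i => by
    simpa [T] using (hg _ (hT m i)).1
  choose e he using hpre
  refine ⟨m, n, hmn, ⟨⟨⟨e, fun i j hij => ?_⟩, fun {i j} => ?_⟩⟩⟩
  · have h1 : g (φ (ψ m i)) = g (φ (ψ m j)) := by rw [← he, ← he, hij]
    exact (ψ m).injective (φ.injective (((hg _ (hT m i)).2 _ (hT m j)).1 h1))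
  · have h1 := ((hg _ (hT m i)).2 _ (hT m j)).2
    rw [← he, ← he, φ.map_adj_iff, φ.map_adj_iff, (ψ m).map_adj_iff, (ψ n).map_adj_iff] at h1
    exact h1

/-! ### The family of graphs -/

instance infinite_triangle : Infinite {p : ℕ × ℕ | p.2 ∈ triangle p.1} :=
  Infinite.of_injective (fun n : ℕ => ⟨(n, 0), Nat.zero_le n⟩)
    fun _ _ h => congrArg (fun p => p.1.1) h

/-- A numbering of the vertices of the sums over the triangular family. -/
noncomputable def triangleEquiv : ℕ ≃ {p : ℕ × ℕ | p.2 ∈ triangle p.1} :=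
  (nonempty_equiv_of_countable).some

/-- The graph on `ℕ` that codes the set `d`. -/
noncomputable def codeGraph (d : Set ℕ) : SimpleGraph ℕ :=
  (wordSumOn sndProj (codeWord d) triangle).comap triangleEquiv

/-- The graph `codeGraph d` is a sum of labelled finite paths. -/
noncomputable def codeGraphIso (d : Set ℕ) :
    codeGraph d ≃g wordSumOn sndProj (codeWord d) triangle :=
  SimpleGraph.Iso.comap triangleEquiv _

theorem not_age_codeGraph_subset {d d' : Set ℕ} (h : d ≠ d') :
    ¬ age (codeGraph d) ⊆ age (codeGraph d') := by
  intro hage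
  obtain ⟨n, hn, hcf⟩ := exists_not_haveCommonFactor_codeWord h
  refine hcf (haveCommonFactor_of_age_subset (exists_letters_codeWord d hn)
    ((codeGraphIso d').toEmbedding.trans (wordSumOnEmbedding _ _ _)) ?_)
  rintro A ⟨f⟩
  exact hage ⟨f.trans (codeGraphIso d).symm.toEmbedding⟩

theorem codeGraph_injective : Function.Injective codeGraph := fun d d' h => by
  by_contra hne
  exact not_age_codeGraph_subset hne (h ▸ subset_rfl)

end PathMinimal

theorem mainTheorem7 :
    ∃ 𝒢 : Set (SimpleGraph ℕ),
      Cardinal.mk 𝒢 = Cardinal.continuum ∧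
      (∀ G ∈ 𝒢,
        PathMinimal.IsPathMinimal G ∧
        ¬ PathMinimal.IsPrimeGraph G ∧
        PathMinimal.HasWqoAge G ∧
        (∀ (W : Type u) (H : SimpleGraph W),
          PathMinimal.Equimorphic G H → ¬ PathMinimal.IsPrimeGraph H) ∧
        ∃ (x : ℕ → Fin 2) (J : ℕ → Set ℕ),
          PathMinimal.UniformlyRecurrent x ∧ PathMinimal.IsUnboundedIntervalFamily J ∧
          Nonempty (G ≃g PathMinimal.wordSumOn PathMinimal.sndProj x J)) ∧
      ∀ G ∈ 𝒢, ∀ G' ∈ 𝒢, G ≠ G' →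
        ¬ PathMinimal.age G ⊆ PathMinimal.age G' ∧
        ¬ PathMinimal.age G' ⊆ PathMinimal.age G := by
  refine ⟨Set.range PathMinimal.codeGraph, ?_, ?_, ?_⟩
  · rw [Cardinal.mk_range_eq _ PathMinimal.codeGraph_injective, Cardinal.mk_set_nat]
  · rintro _ ⟨d, rfl⟩
    have e := PathMinimal.codeGraphIso d
    have hx := PathMinimal.uniformlyRecurrent_toeplitzWord (PathMinimal.codeSeq d)
    have hJ := PathMinimal.isUnboundedIntervalFamily_triangle
    refine ⟨PathMinimal.isPathMinimal_of_iso hx e,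
      PathMinimal.not_isPrimeGraph_of_embedding hJ.2.1 e.toEmbedding,
      PathMinimal.hasWqoAge_of_embedding hx
        (e.toEmbedding.trans (PathMinimal.wordSumOnEmbedding _ _ _)), ?_,
      PathMinimal.codeWord d, PathMinimal.triangle, hx, hJ, ⟨e⟩⟩
    rintro W H ⟨⟨f⟩, ⟨g⟩⟩
    have : Infinite W := Infinite.of_injective f f.injective
    exact PathMinimal.not_isPrimeGraph_of_embedding hJ.2.1 (g.trans e.toEmbedding)
  · rintro _ ⟨d, rfl⟩ _ ⟨d', rfl⟩ h
    have hd : d ≠ d' := fun hd => h (congrArg _ hd)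
    exact ⟨PathMinimal.not_age_codeGraph_subset hd, PathMinimal.not_age_codeGraph_subset hd.symm⟩
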